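/- For a finite graph $G$, a set $P \subseteq E(G)$ separates two edges $e, e'$ of $G$ if it contains exactly one of them. A separating path system of $G$ is a finite family of (edge sets of) paths in $G$ such that any two distinct edges of $G$ are separated by some member of the family; its size is the number of its members, and $f(G)$ denotes the smallest size of a separating path system of $G$. For every integer $n \ge 44$ there is a separating path system of the complete graph $K_n$ of size at most $$\frac{21n + 16\log_2 n + 232}{16}.$$ In particular, $f(K_n) \le \left(\frac{21}{16} + o(1)\right) n$ as $n \to \infty$. -/

import Mathlib

open Filter Topology

namespace SepPath

variable {V : Type*}

/-- The set `P` of edges separates `e` and `e'` if it contains exactly one of them. -/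
def Separates (P : Set (Sym2 V)) (e e' : Sym2 V) : Prop :=
  (e ∈ P ∧ e' ∉ P) ∨ (e' ∈ P ∧ e ∉ P)

/-- A family of sets of edges of `G` such that any two distinct edges of `G` are separated by
some member. -/
def IsSeparatingSystem (G : SimpleGraph V) (S : Set (Set (Sym2 V))) : Prop :=
  (∀ P ∈ S, P ⊆ G.edgeSet) ∧
    ∀ e ∈ G.edgeSet, ∀ e' ∈ G.edgeSet, e ≠ e' → ∃ P ∈ S, Separates P e e'

/-- `P` is the edge set of a path (no repeated vertices) in `G`. -/
def IsPathEdgeSet (G : SimpleGraph V) (P : Set (Sym2 V)) : Prop :=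
  ∃ (u v : V) (w : G.Walk u v), w.IsPath ∧ P = {e | e ∈ w.edges}

/-- A separating system of `G` all of whose members are paths in `G`. -/
def IsSeparatingPathSystem (G : SimpleGraph V) (S : Set (Set (Sym2 V))) : Prop :=
  IsSeparatingSystem G S ∧ ∀ P ∈ S, IsPathEdgeSet G P

/-- The single edges of a finite graph form a separating path system. -/
theorem exists_isSeparatingPathSystem [Finite V] (G : SimpleGraph V) :
    ∃ S : Finset (Set (Sym2 V)), IsSeparatingPathSystem G (S : Set (Set (Sym2 V))) := by
  classical
  have hfin : ((fun e : Sym2 V => ({e} : Set (Sym2 V))) '' G.edgeSet).Finite :=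
    Set.toFinite _
  refine ⟨hfin.toFinset, ?_⟩
  rw [Set.Finite.coe_toFinset]
  refine ⟨⟨?_, ?_⟩, ?_⟩
  · rintro _ ⟨e, he, rfl⟩
    simpa using he
  · intro e he e' _ hne
    exact ⟨{e}, ⟨e, he, rfl⟩, Or.inl ⟨rfl, fun h => hne h.symm⟩⟩
  · rintro _ ⟨e, he, rfl⟩
    induction e using Sym2.ind with
    | _ u v =>
      have h : G.Adj u v := he
      refine ⟨u, v, h.toWalk, SimpleGraph.Walk.IsPath.of_adj h, ?_⟩
      ext x
      simp

/-- `f G`: the least number of paths in a separating path system of the finite graph `G`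
(the minimum is over a nonempty set by `exists_isSeparatingPathSystem`). -/
noncomputable def f [Finite V] (G : SimpleGraph V) : ℕ :=
  sInf {k | ∃ S : Finset (Set (Sym2 V)),
    IsSeparatingPathSystem G (S : Set (Set (Sym2 V))) ∧ S.card = k}

end SepPath

namespace SepPath

variable {V W : Type*}

/-! Let N = 2m + 1 be n or n - 1. The vertices are `ZMod N`, with an extra vertex `none` if n is
even. Colour each edge by the sum of its ends, and {none, x} by 2x. The cyclic edges {x, x + 1} are
handled separately by logarithmically many paths (`exists_cyclic_family`), so the other paths may
use them freely as connectors. Two tasks remain for the noncyclic edges.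

Different colours: a path zigzagging about x contains, apart from cyclic edges, exactly the edges of
colours 2x and 2x + 1. Such paths test membership of a colour in {s, s + 1}, and about 2N/3 of these
pairs already tell all colours apart (`exists_sum_family`).

Equal colours: it suffices to cover every edge by rainbow paths, whose noncyclic edges have distinct
colours (`exists_rainbow_family`). The edges of a fixed length d form g = gcd(d, N) cycles; dropping
one edge from each and joining the remains by cyclic edges gives a rainbow path, for (N - 1)/2
values of d. The dropped edges are chosen so that, for each g, two more rainbow paths cover them
all. An odd N has at most 6 + N/26 proper divisors, so the leading coefficient is at most 2/3 + 1/2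
+ 1/13 < 21/16. -/

/-! ### Paths as sequences of distinct vertices, and their transport along maps. -/

/-- The edges of the path `p 0, p 1, …, p L`. -/
def pathEdges (p : ℕ → V) (L : ℕ) : Set (Sym2 V) :=
  {e | ∃ i < L, e = s(p i, p (i + 1))}

/-- `M` consists of the edges of a sequence of distinct vertices. -/
def IsPathSeq (M : Set (Sym2 V)) : Prop :=
  ∃ (p : ℕ → V) (L : ℕ), Set.InjOn p (Set.Iic L) ∧ M = pathEdges p L

theorem exists_walk_of_injOn (p : ℕ → V) (L : ℕ) (hp : Set.InjOn p (Set.Iic L)) :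
    ∃ w : (⊤ : SimpleGraph V).Walk (p 0) (p L), w.IsPath ∧
      (∀ v, v ∈ w.support ↔ ∃ i ≤ L, v = p i) ∧ ∀ e, e ∈ w.edges ↔ e ∈ pathEdges p L := by
  induction L with
  | zero =>
    refine ⟨SimpleGraph.Walk.nil, SimpleGraph.Walk.IsPath.nil, ?_, ?_⟩
    · intro v; simp
    · intro e; simp [pathEdges]
  | succ L ih =>
    obtain ⟨w, hw, hs, he⟩ := ih (hp.mono (Set.Iic_subset_Iic.2 (Nat.le_succ L)))
    have hadj : (⊤ : SimpleGraph V).Adj (p L) (p (L + 1)) := by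
      rw [SimpleGraph.top_adj]
      intro h
      have := hp (by simp) (by simp) h
      omega
    refine ⟨w.concat hadj, hw.concat ?_ hadj, ?_, ?_⟩
    · rw [hs]
      rintro ⟨i, hi, h⟩
      have := hp (by simp) (Set.mem_Iic.2 (by omega)) h
      omega
    · intro v
      rw [SimpleGraph.Walk.support_concat, List.mem_append, hs]
      constructor
      · rintro (⟨i, hi, rfl⟩ | h)
        · exact ⟨i, by omega, rfl⟩
        · exact ⟨L + 1, le_rfl, by simpa using h⟩
      · rintro ⟨i, hi, rfl⟩
        rcases Nat.lt_or_ge i (L + 1) with h | h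
        · exact Or.inl ⟨i, by omega, rfl⟩
        · obtain rfl : i = L + 1 := by omega
          exact Or.inr (by simp)
    · intro e
      rw [SimpleGraph.Walk.edges_concat, List.concat_eq_append, List.mem_append, he]
      constructor
      · rintro (⟨i, hi, rfl⟩ | h)
        · exact ⟨i, by omega, rfl⟩
        · exact ⟨L, by omega, by simpa using h⟩
      · rintro ⟨i, hi, rfl⟩
        rcases Nat.lt_or_ge i L with h | h
        · exact Or.inl ⟨i, h, rfl⟩
        · obtain rfl : i = L := by omega
          exact Or.inr (by simp)

theorem IsPathSeq.isPathEdgeSet {M : Set (Sym2 V)} (h : IsPathSeq M) :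
    IsPathEdgeSet (⊤ : SimpleGraph V) M := by
  obtain ⟨p, L, hp, rfl⟩ := h
  obtain ⟨w, hw, -, he⟩ := exists_walk_of_injOn p L hp
  exact ⟨_, _, w, hw, by ext e; simp [he]⟩

theorem image_pathEdges (φ : V → W) (p : ℕ → V) (L : ℕ) :
    Sym2.map φ '' pathEdges p L = pathEdges (φ ∘ p) L := by
  ext e
  constructor
  · rintro ⟨_, ⟨i, hi, rfl⟩, rfl⟩
    exact ⟨i, hi, by simp⟩
  · rintro ⟨i, hi, rfl⟩
    exact ⟨_, ⟨i, hi, rfl⟩, by simp⟩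

theorem IsPathSeq.image {M : Set (Sym2 V)} (h : IsPathSeq M) {φ : V → W}
    (hφ : Function.Injective φ) : IsPathSeq (Sym2.map φ '' M) := by
  obtain ⟨p, L, hp, rfl⟩ := h
  exact ⟨φ ∘ p, L, fun i hi j hj hij => hp hi hj (hφ hij), image_pathEdges φ p L⟩

/-- `S` separates any two distinct edges of the complete graph on `V`. -/
def SeparatesAll (S : Finset (Set (Sym2 V))) : Prop :=
  ∀ e e' : Sym2 V, ¬ e.IsDiag → ¬ e'.IsDiag → e ≠ e' → ∃ M ∈ S, Separates M e e'

theorem exists_system_of_equiv (S : Finset (Set (Sym2 V))) (hpath : ∀ M ∈ S, IsPathSeq M)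
    (hsep : SeparatesAll S) (φ : V ≃ W) :
    ∃ S' : Finset (Set (Sym2 W)),
      IsSeparatingPathSystem (⊤ : SimpleGraph W) (S' : Set (Set (Sym2 W))) ∧
        S'.card ≤ S.card := by
  classical
  refine ⟨S.image fun M => Sym2.map φ '' M, ⟨⟨?_, ?_⟩, ?_⟩, Finset.card_image_le⟩
  · intro P hP e he
    simp only [Finset.coe_image, Set.mem_image, Finset.mem_coe] at hP
    obtain ⟨M, hM, rfl⟩ := hP
    obtain ⟨_, _, w, -, h⟩ := ((hpath M hM).image φ.injective).isPathEdgeSet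
    rw [h] at he
    exact w.edges_subset_edgeSet he
  · intro e he e' he' hne
    have hinj : Function.Injective (Sym2.map φ.symm) := Sym2.map.injective φ.symm.injective
    have key : ∀ (M : Set (Sym2 V)) (e : Sym2 W),
        e ∈ Sym2.map φ '' M ↔ Sym2.map φ.symm e ∈ M := by
      intro M e
      constructor
      · rintro ⟨x, hx, rfl⟩
        simpa [Sym2.map_map] using hx
      · intro h
        exact ⟨_, h, by simp [Sym2.map_map]⟩
    have hd : ∀ e : Sym2 W, e ∈ (⊤ : SimpleGraph W).edgeSet → ¬ (Sym2.map φ.symm e).IsDiag := by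
      intro e
      induction e using Sym2.ind with
      | _ u v => simp
    obtain ⟨M, hM, hs⟩ := hsep _ _ (hd e he) (hd e' he') (hinj.ne hne)
    refine ⟨Sym2.map φ '' M, by simpa using ⟨M, hM, rfl⟩, ?_⟩
    simpa only [Separates, key] using hs
  · intro P hP
    simp only [Finset.coe_image, Set.mem_image, Finset.mem_coe] at hP
    obtain ⟨M, hM, rfl⟩ := hP
    exact ((hpath M hM).image φ.injective).isPathEdgeSet

/-- The edges of `S` that avoid the extra vertex. -/
theorem separatesAll_preimage_some {S : Finset (Set (Sym2 (Option V)))} (hsep : SeparatesAll S)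
    [DecidableEq (Set (Sym2 V))] :
    SeparatesAll (S.image fun M => Sym2.map some ⁻¹' M) := by
  intro e e' he he' hne
  have hinj : Function.Injective (Sym2.map (some : V → Option V)) :=
    Sym2.map.injective (Option.some_injective V)
  have hd : ∀ e : Sym2 V, ¬ e.IsDiag → ¬ (Sym2.map some e).IsDiag := by
    intro e
    induction e using Sym2.ind with
    | _ u v => simp
  obtain ⟨M, hM, hs⟩ := hsep _ _ (hd e he) (hd e' he') (hinj.ne hne)
  exact ⟨_, Finset.mem_image_of_mem _ hM, hs⟩

/-! ### Snakes: translates of one sequence joined by cyclic edges. -/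

/-- An edge of the cycle `0, 1, …, N - 1, 0`. -/
def IsCyclicEdge {N : ℕ} (e : Sym2 (ZMod N)) : Prop :=
  ∃ x : ZMod N, e = s(x, x + 1)

/-- The `g` translates of the sequence `g * z 0, …, g * z J`, traversed alternately forwards
and backwards. -/
def snake (N g : ℕ) (z : ℕ → ℤ) (J i : ℕ) : ZMod N :=
  ((g * z (if Even (i / (J + 1)) then i % (J + 1) else J - i % (J + 1)) +
    ((i / (J + 1) : ℕ) : ℤ) : ℤ) : ZMod N)

/-- The edge number `t` of the translate number `r` in `snake N g z J`. -/
def rung (N g : ℕ) (z : ℕ → ℤ) (r t : ℕ) : Sym2 (ZMod N) :=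
  s(((g * z t + r : ℤ) : ZMod N), ((g * z (t + 1) + r : ℤ) : ZMod N))

/-- Reduction modulo g isolates the translate r; cancelling g then leaves a congruence modulo h.
This lets all questions about a snake be settled for `z` modulo h. -/
theorem eq_and_dvd_of_mul_dvd {g h : ℕ} (hg : 0 < g) {a b : ℤ} {r r' : ℕ} (hr : r < g)
    (hr' : r' < g) (H : ((g * h : ℕ) : ℤ) ∣ (g * a + r) - (g * b + r')) :
    r = r' ∧ (h : ℤ) ∣ a - b := by
  have hg' : (g : ℤ) ≠ 0 := by exact_mod_cast hg.ne'
  have h1 : (g : ℤ) ∣ (r : ℤ) - r' := by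
    have h2 : (g : ℤ) ∣ (g * a + r) - (g * b + r') :=
      (Dvd.intro (h : ℤ) (by push_cast; ring)).trans H
    have h3 := h2.sub (Dvd.intro (a - b) rfl : (g : ℤ) ∣ g * (a - b))
    have h4 : (g * a + r : ℤ) - (g * b + r') - g * (a - b) = r - r' := by ring
    rwa [h4] at h3
  have hrr : (r : ℤ) - r' = 0 :=
    Int.eq_zero_of_abs_lt_dvd h1 (by rw [abs_lt]; omega)
  have hrr' : r = r' := by omega
  subst hrr'
  refine ⟨rfl, ?_⟩
  have h5 : (g * a + r : ℤ) - (g * b + r) = g * (a - b) := by ring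
  rw [h5] at H
  push_cast at H
  exact Int.dvd_of_mul_dvd_mul_left hg' H

theorem snake_mul_add (N g : ℕ) (z : ℕ → ℤ) (J r t : ℕ) (ht : t ≤ J) :
    snake N g z J ((J + 1) * r + t) =
      ((g * z (if Even r then t else J - t) + (r : ℤ) : ℤ) : ZMod N) := by
  have h1 : ((J + 1) * r + t) / (J + 1) = r := by
    rw [Nat.mul_add_div (by omega), Nat.div_eq_of_lt (by omega), add_zero]
  have h2 : ((J + 1) * r + t) % (J + 1) = t := by
    rw [Nat.mul_add_mod, Nat.mod_eq_of_lt (by omega)]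
  simp only [snake, h1, h2]

theorem exists_eq_mul_add (J i : ℕ) : ∃ r t, t ≤ J ∧ i = (J + 1) * r + t :=
  ⟨i / (J + 1), i % (J + 1), by have := Nat.mod_lt i (by omega : 0 < J + 1); omega,
    (Nat.div_add_mod i (J + 1)).symm⟩

theorem snake_injOn {N g h J : ℕ} {z : ℕ → ℤ} (hN : N = g * h) (hg : 0 < g)
    (hz : ∀ s ≤ J, ∀ t ≤ J, (h : ℤ) ∣ z s - z t → s = t) :
    Set.InjOn (snake N g z J) (Set.Iic ((J + 1) * g - 1)) := by
  intro i hi j hj hij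
  have hpos : 0 < (J + 1) * g := by positivity
  rw [Set.mem_Iic] at hi hj
  obtain ⟨r, t, ht, rfl⟩ := exists_eq_mul_add J i
  obtain ⟨r', t', ht', rfl⟩ := exists_eq_mul_add J j
  have hr : r < g := by
    by_contra hc
    have := Nat.mul_le_mul_left (J + 1) (not_lt.1 hc)
    omega
  have hr' : r' < g := by
    by_contra hc
    have := Nat.mul_le_mul_left (J + 1) (not_lt.1 hc)
    omega
  rw [snake_mul_add _ _ _ _ _ _ ht, snake_mul_add _ _ _ _ _ _ ht', eq_comm,
    ZMod.intCast_eq_intCast_iff_dvd_sub, hN] at hij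
  obtain ⟨rfl, hd⟩ := eq_and_dvd_of_mul_dvd hg hr hr' hij
  have := hz _ (by split_ifs <;> omega) _ (by split_ifs <;> omega) hd
  have : t = t' := by
    split_ifs at this <;> omega
  rw [this]

/-- Because the direction alternates, one translate ends at the same term of `z` at which the next
begins, so the connecting step adds exactly 1. -/
theorem mem_snake_edges {N g J : ℕ} {z : ℕ → ℤ} {e : Sym2 (ZMod N)}
    (he : e ∈ pathEdges (snake N g z J) ((J + 1) * g - 1)) :
    IsCyclicEdge e ∨ ∃ r < g, ∃ t < J, e = rung N g z r t := by
  obtain ⟨i, hi, rfl⟩ := he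
  obtain ⟨r, t, ht, rfl⟩ := exists_eq_mul_add J i
  have hr : r < g := by
    by_contra hc
    have := Nat.mul_le_mul_left (J + 1) (not_lt.1 hc)
    omega
  rcases Nat.lt_or_ge t J with h | h
  · right
    rw [snake_mul_add _ _ _ _ _ _ ht, add_assoc, snake_mul_add _ _ _ _ _ _ h]
    by_cases hev : Even r
    · exact ⟨r, hr, t, h, by simp [rung, hev]⟩
    · refine ⟨r, hr, J - (t + 1), by omega, ?_⟩
      have h1 : J - (t + 1) + 1 = J - t := by omega
      simp only [rung, hev, if_false, h1, Sym2.eq_swap]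
  · left
    obtain rfl : t = J := le_antisymm ht h
    have h1 : (t + 1) * r + t + 1 = (t + 1) * (r + 1) + 0 := by ring
    rw [h1, snake_mul_add _ _ _ _ _ _ ht, snake_mul_add _ _ _ _ _ _ (Nat.zero_le _)]
    refine ⟨_, congrArg₂ _ rfl ?_⟩
    by_cases hev : Even r
    · have : ¬ Even (r + 1) := by simpa [Nat.even_add_one] using hev
      simp only [hev, this, if_true, if_false]
      push_cast
      simp [add_assoc]
    · have : Even (r + 1) := by simpa [Nat.even_add_one] using hev
      simp only [hev, this, if_true, if_false]
      push_cast
      simp [add_assoc]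

theorem rung_mem_snake_edges {N g J : ℕ} {z : ℕ → ℤ} {r t : ℕ} (hr : r < g) (ht : t < J) :
    rung N g z r t ∈ pathEdges (snake N g z J) ((J + 1) * g - 1) := by
  have hle := Nat.mul_le_mul_left (J + 1) (Nat.succ_le_of_lt hr)
  have hexp : (J + 1) * (r + 1) = (J + 1) * r + J + 1 := by ring
  rw [Nat.succ_eq_add_one, hexp] at hle
  by_cases hev : Even r
  · refine ⟨(J + 1) * r + t, by omega, ?_⟩
    rw [snake_mul_add _ _ _ _ _ _ ht.le, add_assoc, snake_mul_add _ _ _ _ _ _ ht]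
    simp [rung, hev]
  · refine ⟨(J + 1) * r + (J - (t + 1)), by omega, ?_⟩
    rw [snake_mul_add _ _ _ _ _ _ (by omega), add_assoc, snake_mul_add _ _ _ _ _ _ (by omega)]
    have h1 : J - (J - (t + 1)) = t + 1 := by omega
    have h2 : J - (J - (t + 1) + 1) = t := by omega
    simp only [rung, hev, if_false, h1, h2, Sym2.eq_swap]

/-! ### Rainbow paths. -/

/-- The sum of the two ends of an edge. -/
def endSum {N : ℕ} : Sym2 (ZMod N) → ZMod N :=
  Sym2.lift ⟨fun x y => x + y, add_comm⟩

@[simp] theorem endSum_mk {N : ℕ} (x y : ZMod N) : endSum s(x, y) = x + y := rfl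

theorem rung_eq_of_endSum_eq {N g h J : ℕ} {z : ℕ → ℤ} (hN : N = g * h) (hg : 0 < g)
    (hodd : Odd g)
    (hs : ∀ s < J, ∀ t < J, (h : ℤ) ∣ (z s + z (s + 1)) - (z t + z (t + 1)) → s = t)
    {r t r' t' : ℕ} (hr : r < g) (ht : t < J) (hr' : r' < g) (ht' : t' < J)
    (H : endSum (rung N g z r t) = endSum (rung N g z r' t')) :
    rung N g z r t = rung N g z r' t' := by
  rw [rung, rung, endSum_mk, endSum_mk, ← Int.cast_add, ← Int.cast_add, eq_comm,
    ZMod.intCast_eq_intCast_iff_dvd_sub, hN] at H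
  have hrr : r = r' := by
    -- Modulo g the sum of a rung of translate r is 2r, and g is odd.
    have h2 : (g : ℤ) ∣ 2 * ((r : ℤ) - r') := by
      have h1 : (g : ℤ) ∣ ((g * h : ℕ) : ℤ) := ⟨h, by push_cast; ring⟩
      have h3 := (h1.trans H).sub
        (Dvd.intro (z t + z (t + 1) - (z t' + z (t' + 1))) rfl : (g : ℤ) ∣ g * _)
      have h4 : (g * z t + r + (g * z (t + 1) + r) - (g * z t' + r' + (g * z (t' + 1) + r')) -
          g * (z t + z (t + 1) - (z t' + z (t' + 1))) : ℤ) = 2 * (r - r') := by ring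
      rwa [h4] at h3
    have hcop : IsCoprime (g : ℤ) 2 := by
      have := Nat.isCoprime_iff_coprime.2 (Nat.coprime_two_right.2 hodd)
      simpa using this
    have h3 := hcop.dvd_of_dvd_mul_left h2
    have : (r : ℤ) - r' = 0 := Int.eq_zero_of_abs_lt_dvd h3 (by rw [abs_lt]; omega)
    omega
  subst hrr
  have h1 : ((g * h : ℕ) : ℤ) ∣ (g * (z t + z (t + 1)) + (0 : ℕ)) -
      (g * (z t' + z (t' + 1)) + (0 : ℕ)) := by
    have h4 : (g * z t + r + (g * z (t + 1) + r) - (g * z t' + r + (g * z (t' + 1) + r)) : ℤ) =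
        (g * (z t + z (t + 1)) + (0 : ℕ)) - (g * (z t' + z (t' + 1)) + (0 : ℕ)) := by
      push_cast
      ring
    rwa [h4] at H
  obtain ⟨-, h2⟩ := eq_and_dvd_of_mul_dvd hg hg hg h1
  rw [hs t ht t' ht' h2]

/-- All noncyclic edges of `M` have different end sums. -/
def IsRainbow {N : ℕ} (M : Set (Sym2 (ZMod N))) : Prop :=
  ∀ e ∈ M, ∀ e' ∈ M, ¬ IsCyclicEdge e → ¬ IsCyclicEdge e' → endSum e = endSum e' → e = e'

theorem isRainbow_snake {N g h J : ℕ} {z : ℕ → ℤ} (hN : N = g * h) (hg : 0 < g)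
    (hodd : Odd g)
    (hs : ∀ s < J, ∀ t < J, (h : ℤ) ∣ (z s + z (s + 1)) - (z t + z (t + 1)) → s = t) :
    IsRainbow (pathEdges (snake N g z J) ((J + 1) * g - 1)) := by
  intro e he e' he' hc hc' H
  obtain ⟨r, hr, t, ht, rfl⟩ := (mem_snake_edges he).resolve_left hc
  obtain ⟨r', hr', t', ht', rfl⟩ := (mem_snake_edges he').resolve_left hc'
  exact rung_eq_of_endSum_eq hN hg hodd hs hr ht hr' ht' H

/-- The path visits the elements of `K` below N in increasing order. It also uses long edges, which
do not matter here. `K` is required to be unbounded only so that `Nat.nth` never takes its default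
value. -/
theorem exists_increasing_path {N : ℕ} (K : ℕ → Prop) [DecidablePred K]
    (hK0 : K 0) (hK : ∀ a, ∃ b, K b ∧ a < b) (hN : 0 < N) :
    ∃ M : Set (Sym2 (ZMod N)), IsPathSeq M ∧
      ∀ x, x + 1 < N → (s(((x : ℕ) : ZMod N), ((x + 1 : ℕ) : ZMod N)) ∈ M ↔ K x ∧ K (x + 1)) := by
  have hinf : (Set.ofPred K).Infinite := Set.infinite_of_forall_exists_gt hK
  have hc : 0 < Nat.count K N :=
    (Nat.zero_le _).trans_lt (Nat.count_strict_mono hK0 hN)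
  have cast_inj : ∀ a b : ℕ, a < N → b < N → ((a : ℕ) : ZMod N) = (b : ℕ) → a = b := by
    intro a b ha hb hab
    rw [ZMod.natCast_eq_natCast_iff'] at hab
    rwa [Nat.mod_eq_of_lt ha, Nat.mod_eq_of_lt hb] at hab
  refine ⟨pathEdges (fun i => ((Nat.nth K i : ℕ) : ZMod N)) (Nat.count K N - 1),
    ⟨_, _, ?_, rfl⟩, ?_⟩
  · intro i hi j hj hij
    rw [Set.mem_Iic] at hi hj
    exact Nat.nth_injective hinf (cast_inj _ _ (Nat.nth_lt_of_lt_count (by omega))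
      (Nat.nth_lt_of_lt_count (by omega)) hij)
  · intro x hx
    constructor
    · rintro ⟨i, hi, h⟩
      have h1 : Nat.nth K i < N := Nat.nth_lt_of_lt_count (by omega)
      have h2 : Nat.nth K (i + 1) < N := Nat.nth_lt_of_lt_count (by omega)
      have h3 := Nat.nth_mem_of_infinite hinf i
      have h4 := Nat.nth_mem_of_infinite hinf (i + 1)
      rcases Sym2.eq_iff.1 h with ⟨ha, hb⟩ | ⟨ha, hb⟩
      · rw [← cast_inj _ _ (by omega) h1 ha] at h3
        rw [← cast_inj _ _ hx h2 hb] at h4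
        exact ⟨h3, h4⟩
      · rw [← cast_inj _ _ (by omega) h2 ha] at h4
        rw [← cast_inj _ _ hx h1 hb] at h3
        exact ⟨h4, h3⟩
    · rintro ⟨h1, h2⟩
      have h3 : Nat.count K (x + 1) = Nat.count K x + 1 := by
        rw [Nat.count_succ, if_pos h1]
      have h4 : Nat.count K (x + 1) < Nat.count K N := Nat.count_strict_mono h2 hx
      refine ⟨Nat.count K x, by omega, ?_⟩
      simp only [← h3, Nat.nth_count h1, Nat.nth_count h2]

/-! ### Separating the cyclic edges. -/

/-- Paths that separate the cyclic edges from each other and from all the other edges. -/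
theorem exists_cyclic_family {N : ℕ} (hN : 3 ≤ N) :
    ∃ S : Finset (Set (Sym2 (ZMod N))), (∀ M ∈ S, IsPathSeq M) ∧ S.card ≤ Nat.log 2 N + 3 ∧
      ∀ e e' : Sym2 (ZMod N), IsCyclicEdge e → e ≠ e' → ∃ M ∈ S, Separates M e e' := by
  classical
  have : NeZero N := ⟨by omega⟩
  have cast_inj : ∀ a b : ℕ, a < N → b < N → ((a : ℕ) : ZMod N) = (b : ℕ) → a = b := by
    intro a b ha hb hab
    rw [ZMod.natCast_eq_natCast_iff'] at hab
    rwa [Nat.mod_eq_of_lt ha, Nat.mod_eq_of_lt hb] at hab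
  -- All even vertices are kept, so a cyclic edge lies on `B j` exactly when bit j + 1 of its odd
  -- end is set. Bit 0 carries no information.
  have hbit (j : ℕ) := exists_increasing_path (N := N)
    (fun v => v % 2 = 0 ∨ v.testBit (j + 1) = true) (Or.inl rfl)
    (fun a => ⟨2 * (a + 1), Or.inl (by omega), by omega⟩) (by omega)
  choose B hBp hB using hbit
  -- Of the two even neighbours of an odd vertex exactly one is 2 modulo 4, so `O` separates the two
  -- cyclic edges at that vertex.
  obtain ⟨O, hOp, hO⟩ := exists_increasing_path (N := N) (fun v => v % 4 ≠ 2) (by simp)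
    (fun a => ⟨4 * (a + 1), by omega, by omega⟩) (by omega)
  set C : Set (Sym2 (ZMod N)) := pathEdges (fun i => ((i : ℕ) : ZMod N)) (N - 1) with hC
  -- The single edge from N - 1 to 0, the only cyclic edge missing from `C`.
  set D : Set (Sym2 (ZMod N)) := pathEdges (fun i => ((N - 1 + i : ℕ) : ZMod N)) 1 with hD
  refine ⟨insert C (insert D (insert O ((Finset.range (Nat.log 2 N)).image B))), ?_, ?_, ?_⟩
  · intro M hM
    simp only [Finset.mem_insert, Finset.mem_image] at hM
    rcases hM with rfl | rfl | rfl | ⟨j, -, rfl⟩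
    · refine ⟨_, _, ?_, hC⟩
      intro i hi j hj hij
      rw [Set.mem_Iic] at hi hj
      exact cast_inj _ _ (by omega) (by omega) hij
    · refine ⟨_, _, ?_, hD⟩
      intro i hi j hj hij
      rw [Set.mem_Iic] at hi hj
      have h := (ZMod.natCast_eq_natCast_iff _ _ _).1 hij
      have h2 : i ≡ j [MOD N] := Nat.ModEq.add_left_cancel' _ h
      exact Nat.ModEq.eq_of_lt_of_lt h2 (by omega) (by omega)
    · exact hOp
    · exact hBp j
  · refine (Finset.card_insert_le _ _).trans (Nat.succ_le_succ ((Finset.card_insert_le _ _).trans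
      (Nat.succ_le_succ ((Finset.card_insert_le _ _).trans (Nat.succ_le_succ ?_)))))
    exact Finset.card_image_le.trans (by simp)
  · rintro _ e' ⟨x, rfl⟩ hne
    obtain ⟨a, ha, rfl⟩ : ∃ a : ℕ, a < N ∧ x = (a : ZMod N) :=
      ⟨x.val, ZMod.val_lt x, (ZMod.natCast_zmod_val x).symm⟩
    rw [← Nat.cast_succ] at hne ⊢
    rcases Nat.lt_or_ge (a + 1) N with ha1 | ha1
    swap
    · refine ⟨D, by simp, Or.inl ⟨⟨0, one_pos, ?_⟩, ?_⟩⟩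
      · obtain rfl : a = N - 1 := by omega
        rfl
      · rintro ⟨i, hi, rfl⟩
        obtain rfl : i = 0 := by omega
        obtain rfl : a = N - 1 := by omega
        exact hne rfl
    have haC : s(((a : ℕ) : ZMod N), ((a + 1 : ℕ) : ZMod N)) ∈ C := ⟨a, by omega, rfl⟩
    by_cases hC' : e' ∈ C
    swap
    · exact ⟨C, by simp, Or.inl ⟨haC, hC'⟩⟩
    obtain ⟨b, hb, rfl⟩ := hC'
    have hab : a ≠ b := by
      rintro rfl
      exact hne rfl
    have hsep : ∀ M : Set (Sym2 (ZMod N)), ¬ (s(((a : ℕ) : ZMod N), ((a + 1 : ℕ) : ZMod N)) ∈ M ↔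
        s(((b : ℕ) : ZMod N), ((b + 1 : ℕ) : ZMod N)) ∈ M) →
        Separates M s(((a : ℕ) : ZMod N), ((a + 1 : ℕ) : ZMod N))
          s(((b : ℕ) : ZMod N), ((b + 1 : ℕ) : ZMod N)) := by
      intro M h
      unfold Separates
      tauto
    -- the odd end of the edge from `c` to `c + 1`
    set o : ℕ → ℕ := fun c => c / 2 * 2 + 1 with ho
    by_cases hoo : o a = o b
    · refine ⟨O, by simp, hsep _ ?_⟩
      rw [hO a ha1, hO b (by omega)]
      simp only [ho] at hoo
      omega
    · obtain ⟨i, hi⟩ := Nat.exists_testBit_ne_of_ne hoo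
      obtain ⟨j, rfl⟩ : ∃ j, i = j + 1 := by
        cases i with
        | zero => simp [ho, Nat.testBit_zero] at hi
        | succ j => exact ⟨j, rfl⟩
      have hB' : ∀ c, c + 1 < N → (s(((c : ℕ) : ZMod N), ((c + 1 : ℕ) : ZMod N)) ∈ B j ↔
          (o c).testBit (j + 1) = true) := by
        intro c hc
        rw [hB j c hc]
        rcases Nat.even_or_odd' c with ⟨m, rfl | rfl⟩
        · have h1 : o (2 * m) = 2 * m + 1 := by simp only [ho]; omega
          rw [h1]
          simp
        · have h1 : o (2 * m + 1) = 2 * m + 1 := by simp only [ho]; omega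
          have h3 : (2 * m + 1 + 1) % 2 = 0 := by omega
          rw [h1]
          simp [h3]
      have hlog : ∀ c, c + 1 < N → (o c).testBit (j + 1) = true → j < Nat.log 2 N := by
        intro c hc h
        have h1 : 2 ^ (j + 1) ≤ N :=
          (Nat.ge_two_pow_of_testBit h).trans (by simp only [ho]; omega)
        exact Nat.le_log_of_pow_le (by norm_num) h1
      have hj : j < Nat.log 2 N := by
        by_cases h : (o a).testBit (j + 1) = true
        · exact hlog a ha1 h
        · refine hlog b (by omega) ?_
          rw [Bool.not_eq_true] at h
          rw [h] at hi
          simpa using hi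
      refine ⟨B j, ?_, hsep _ ?_⟩
      · simp only [Finset.mem_insert, Finset.mem_image, Finset.mem_range]
        exact Or.inr (Or.inr (Or.inr ⟨j, hj, rfl⟩))
      · rw [hB' a ha1, hB' b (by omega)]
        intro h
        exact hi (Bool.eq_iff_iff.2 h)

/-! ### Covering all edges by rainbow paths. -/

theorem eq_of_dvd_mul {h : ℕ} {c : ℕ} (hc : Nat.Coprime h c) {s t : ℕ} (hs : s < h) (ht : t < h)
    (H : (h : ℤ) ∣ ((s : ℤ) - t) * c) : s = t := by
  have h1 : (h : ℤ) ∣ (s : ℤ) - t := (Nat.isCoprime_iff_coprime.2 hc).dvd_of_dvd_mul_right H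
  have := Int.eq_zero_of_abs_lt_dvd h1 (by rw [abs_lt]; omega)
  omega

/-- The arithmetic progression of step `k` starting at `k / 4 + k % 2`. -/
def progression (k t : ℕ) : ℤ := ((k / 4 + k % 2 : ℕ) : ℤ) + t * k

/-- The sequence `0, 1, -3, 2, -6, 3, …`. -/
def zigzagA (t : ℕ) : ℤ := if t % 2 = 0 then -3 * ((t / 2 : ℕ) : ℤ) else ((t / 2 : ℕ) : ℤ) + 1

/-- The sequence `0, -2, 1, -5, 2, -8, …`. -/
def zigzagB (t : ℕ) : ℤ := if t % 2 = 0 then ((t / 2 : ℕ) : ℤ) else -3 * ((t / 2 : ℕ) : ℤ) - 2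

/-- The sequence `z`, up to `z J`, repeats neither a value nor a sum of consecutive values
modulo `h`. -/
def IsRainbowSeq (h : ℕ) (z : ℕ → ℤ) (J : ℕ) : Prop :=
  (∀ s ≤ J, ∀ t ≤ J, (h : ℤ) ∣ z s - z t → s = t) ∧
    ∀ s < J, ∀ t < J, (h : ℤ) ∣ (z s + z (s + 1)) - (z t + z (t + 1)) → s = t

theorem IsRainbowSeq.snake {N g h J : ℕ} {z : ℕ → ℤ} (H : IsRainbowSeq h z J) (hN : N = g * h)
    (hodd : Odd N) :
    IsPathSeq (pathEdges (snake N g z J) ((J + 1) * g - 1)) ∧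
      IsRainbow (pathEdges (SepPath.snake N g z J) ((J + 1) * g - 1)) := by
  have hg : Odd g := by
    rw [hN, Nat.odd_mul] at hodd
    exact hodd.1
  exact ⟨⟨_, _, snake_injOn hN hg.pos H.1, rfl⟩, isRainbow_snake hN hg.pos hg H.2⟩

theorem isRainbowSeq_progression {h k : ℕ} (hodd : Odd h) (hk : Nat.Coprime h k) :
    IsRainbowSeq h (progression k) (h - 1) := by
  have hpos := hodd.pos
  constructor
  · intro s hs t ht H
    refine eq_of_dvd_mul hk (by omega) (by omega) ?_
    have h1 : progression k s - progression k t = ((s : ℤ) - t) * k := by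
      simp only [progression]
      ring
    rwa [h1] at H
  · intro s hs t ht H
    refine eq_of_dvd_mul (c := 2 * k) (Nat.Coprime.mul_right (Nat.coprime_two_right.2 hodd) hk)
      (by omega) (by omega) ?_
    have h1 : progression k s + progression k (s + 1) - (progression k t + progression k (t + 1)) =
        ((s : ℤ) - t) * (2 * k : ℕ) := by
      simp only [progression]
      push_cast
      ring
    rwa [h1] at H

/-- Up to this index, any two values and any two consecutive sums (1, -2, -1, -4, -3, …) differ by
less than h, so congruence modulo h is equality. -/
theorem isRainbowSeq_zigzagA {h : ℕ} (hh : 3 ≤ h) : IsRainbowSeq h zigzagA ((h + 1) / 4) := by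
  constructor
  · intro s hs t ht H
    have h1 := Int.eq_zero_of_abs_lt_dvd H
      (by rw [abs_lt]; simp only [zigzagA]; split_ifs <;> omega)
    simp only [zigzagA] at h1
    split_ifs at h1 <;> omega
  · intro s hs t ht H
    have h1 := Int.eq_zero_of_abs_lt_dvd H
      (by rw [abs_lt]; simp only [zigzagA]; split_ifs <;> omega)
    simp only [zigzagA] at h1
    split_ifs at h1 <;> omega

theorem isRainbowSeq_zigzagB {h : ℕ} (hh : 3 ≤ h) : IsRainbowSeq h zigzagB ((h + 1) / 4) := by
  constructor
  · intro s hs t ht H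
    have h1 := Int.eq_zero_of_abs_lt_dvd H
      (by rw [abs_lt]; simp only [zigzagB]; split_ifs <;> omega)
    simp only [zigzagB] at h1
    split_ifs at h1 <;> omega
  · intro s hs t ht H
    have h1 := Int.eq_zero_of_abs_lt_dvd H
      (by rw [abs_lt]; simp only [zigzagB]; split_ifs <;> omega)
    simp only [zigzagB] at h1
    split_ifs at h1 <;> omega

/-- This explains the start k/4 + k % 2 of `progression`: the edge that closes the progression of
step k to a cycle joins the start to start - k. With this choice these edges line up for varying k,
those with k ≡ 0, 1 modulo 4 along `zigzagA` and the rest along `zigzagB`. -/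
theorem exists_zigzag_edge {h k : ℕ} (hk : 0 < k) (hkh : 2 * k < h) :
    ∃ t < (h + 1) / 4, ∃ z, (z = zigzagA ∨ z = zigzagB) ∧
      ((z t = (k / 4 + k % 2 : ℕ) ∧ z (t + 1) = ((k / 4 + k % 2 : ℕ) : ℤ) - k) ∨
        (z (t + 1) = (k / 4 + k % 2 : ℕ) ∧ z t = ((k / 4 + k % 2 : ℕ) : ℤ) - k)) := by
  refine ⟨(k - 1) / 2, by omega, ?_⟩
  by_cases hA : k % 4 ≤ 1
  · refine ⟨zigzagA, Or.inl rfl, ?_⟩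
    simp only [zigzagA]
    split_ifs <;> omega
  · refine ⟨zigzagB, Or.inr rfl, ?_⟩
    simp only [zigzagB]
    split_ifs <;> omega

theorem exists_eq_add_of_ne {N : ℕ} [NeZero N] {e : Sym2 (ZMod N)} (he : ¬ e.IsDiag) :
    ∃ x d : ℕ, 0 < d ∧ 2 * d ≤ N ∧ e = s((x : ZMod N), ((x + d : ℕ) : ZMod N)) := by
  have key : ∀ a b : ℕ, a < b → b < N → ∃ x d : ℕ, 0 < d ∧ 2 * d ≤ N ∧
      s((a : ZMod N), (b : ZMod N)) = s((x : ZMod N), ((x + d : ℕ) : ZMod N)) := by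
    intro a b hab hb
    rcases Nat.le_total (2 * (b - a)) N with h | h
    · exact ⟨a, b - a, by omega, h, by rw [Nat.add_sub_cancel' hab.le]⟩
    · refine ⟨b, N - (b - a), by omega, by omega, ?_⟩
      have h1 : b + (N - (b - a)) = a + N := by omega
      rw [h1, Sym2.eq_swap]
      simp
  induction e using Sym2.ind with
  | _ x y =>
    rw [Sym2.mk_isDiag_iff] at he
    rw [← ZMod.natCast_zmod_val x, ← ZMod.natCast_zmod_val y]
    rcases lt_trichotomy x.val y.val with h | h | h
    · exact key _ _ h (ZMod.val_lt y)
    · exact absurd (ZMod.val_injective N h) he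
    · rw [Sym2.eq_swap]
      exact key _ _ h (ZMod.val_lt x)

theorem rung_eq_of_modEq {N g h : ℕ} (hN : N = g * h) {z : ℕ → ℤ} {r t : ℕ} {a b : ℤ}
    (ha : (h : ℤ) ∣ a - z t) (hb : (h : ℤ) ∣ b - z (t + 1)) :
    rung N g z r t = s(((g * a + r : ℤ) : ZMod N), ((g * b + r : ℤ) : ZMod N)) := by
  have key : ∀ u v : ℤ, (h : ℤ) ∣ v - u →
      ((g * u + r : ℤ) : ZMod N) = ((g * v + r : ℤ) : ZMod N) := by
    intro u v huv
    rw [ZMod.intCast_eq_intCast_iff_dvd_sub, hN]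
    have h1 : (g * v + r : ℤ) - (g * u + r) = g * (v - u) := by ring
    rw [h1, Nat.cast_mul]
    exact mul_dvd_mul_left _ huv
  rw [rung, key _ _ ha, key _ _ hb]

/-- One snake `P d` for each length d, and two zigzag snakes `A g`, `B g` for each possible gcd g,
to collect the edges that the `P d` leave out. -/
theorem exists_rainbow_family {N : ℕ} (hodd : Odd N) :
    ∃ S : Finset (Set (Sym2 (ZMod N))), (∀ M ∈ S, IsPathSeq M ∧ IsRainbow M) ∧
      S.card ≤ (N - 1) / 2 + 2 * N.properDivisors.card ∧
        ∀ e : Sym2 (ZMod N), ¬ e.IsDiag → ∃ M ∈ S, e ∈ M := by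
  classical
  have : NeZero N := ⟨hodd.pos.ne'⟩
  set F : ℕ → (ℕ → ℤ) → ℕ → Set (Sym2 (ZMod N)) := fun g z J =>
    pathEdges (snake N g z J) ((J + 1) * g - 1) with hF
  set P : ℕ → Set (Sym2 (ZMod N)) := fun d =>
    F (d.gcd N) (progression (d / d.gcd N)) (N / d.gcd N - 1) with hP
  set A : ℕ → Set (Sym2 (ZMod N)) := fun g => F g zigzagA ((N / g + 1) / 4) with hA
  set B : ℕ → Set (Sym2 (ZMod N)) := fun g => F g zigzagB ((N / g + 1) / 4) with hB
  have hprop : ∀ g ∈ N.properDivisors, N = g * (N / g) ∧ 3 ≤ N / g := by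
    intro g hg
    rw [Nat.mem_properDivisors] at hg
    have h1 : N = g * (N / g) := (Nat.mul_div_cancel' hg.1).symm
    have h2 : Odd (N / g) := by
      have h3 := hodd
      rw [h1, Nat.odd_mul] at h3
      exact h3.2
    refine ⟨h1, ?_⟩
    obtain ⟨m, hm⟩ := h2
    rcases Nat.eq_zero_or_pos m with rfl | h
    · rw [hm] at h1
      omega
    · omega
  refine ⟨(Finset.Icc 1 ((N - 1) / 2)).image P ∪ (N.properDivisors.image A ∪
    N.properDivisors.image B), ?_, ?_, ?_⟩
  · intro M hM
    simp only [Finset.mem_union, Finset.mem_image, Finset.mem_Icc] at hM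
    rcases hM with ⟨d, hd, rfl⟩ | ⟨g, hg, rfl⟩ | ⟨g, hg, rfl⟩
    · have hg : 0 < d.gcd N := Nat.gcd_pos_of_pos_right _ hodd.pos
      have h1 : N = d.gcd N * (N / d.gcd N) := (Nat.mul_div_cancel' (Nat.gcd_dvd_right d N)).symm
      have h2 : Odd (N / d.gcd N) := by
        have h3 := hodd
        rw [h1, Nat.odd_mul] at h3
        exact h3.2
      exact (isRainbowSeq_progression h2
        (Nat.coprime_div_gcd_div_gcd hg).symm).snake h1 hodd
    · exact (isRainbowSeq_zigzagA (hprop g hg).2).snake (hprop g hg).1 hodd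
    · exact (isRainbowSeq_zigzagB (hprop g hg).2).snake (hprop g hg).1 hodd
  · refine (Finset.card_union_le _ _).trans (Nat.add_le_add ?_ ?_)
    · exact Finset.card_image_le.trans (by simp)
    · rw [two_mul]
      exact (Finset.card_union_le _ _).trans
        (Nat.add_le_add Finset.card_image_le Finset.card_image_le)
  · intro e he
    obtain ⟨x, d, hd, hdN, rfl⟩ := exists_eq_add_of_ne he
    obtain ⟨m, hm⟩ := hodd
    have hg : 0 < d.gcd N := Nat.gcd_pos_of_pos_left _ hd
    have hPd : P d = F (d.gcd N) (progression (d / d.gcd N)) (N / d.gcd N - 1) := rfl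
    obtain ⟨k, hk⟩ := Nat.gcd_dvd_left d N
    obtain ⟨h, hh⟩ := Nat.gcd_dvd_right d N
    have hcop := Nat.coprime_div_gcd_div_gcd (m := d) (n := N) hg
    have hk' : d / d.gcd N = k := Nat.div_eq_of_eq_mul_right hg hk
    have hh' : N / d.gcd N = h := Nat.div_eq_of_eq_mul_right hg hh
    have hgN : d.gcd N ∈ N.properDivisors := by
      rw [Nat.mem_properDivisors]
      exact ⟨Nat.gcd_dvd_right d N, (Nat.gcd_le_left _ hd).trans_lt (by omega)⟩
    rw [hk', hh'] at hcop hPd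
    generalize d.gcd N = g at *
    have hkpos : 0 < k := Nat.pos_of_ne_zero (by rintro rfl; omega)
    have hkh : 2 * k < h := by
      have h1 : g * (2 * k) < g * h := by
        rw [← hh, mul_left_comm, ← hk]
        omega
      exact lt_of_mul_lt_mul_left h1 (Nat.zero_le g)
    have hr : x % g < g := Nat.mod_lt _ hg
    have hx : x = g * (x / g) + x % g := (Nat.div_add_mod x g).symm
    generalize x % g = r at *
    generalize x / g = c at *
    -- the number of steps from the start of the progression to `c`
    obtain ⟨t, ht, hct⟩ : ∃ t < h, (h : ℤ) ∣ (c : ℤ) - progression k t := by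
      have hh0 : NeZero h := ⟨by omega⟩
      set u : ZMod h := ((c : ZMod h) - ((k / 4 + k % 2 : ℕ) : ZMod h)) * (k : ZMod h)⁻¹ with hu
      refine ⟨u.val, ZMod.val_lt u, ?_⟩
      rw [← ZMod.intCast_eq_intCast_iff_dvd_sub]
      have h1 : (k : ZMod h)⁻¹ * (k : ZMod h) = 1 :=
        (mul_comm _ _).trans (ZMod.coe_mul_inv_eq_one k hcop)
      simp only [progression, Int.cast_add, Int.cast_mul, Int.cast_natCast]
      rw [ZMod.natCast_zmod_val, hu, mul_assoc, h1]
      ring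
    have hct' : (h : ℤ) ∣ ((c : ℤ) + k) - progression k (t + 1) := by
      have h1 : ((c : ℤ) + k) - progression k (t + 1) = (c : ℤ) - progression k t := by
        simp only [progression]
        push_cast
        ring
      rwa [h1]
    have hedge : s((x : ZMod N), ((x + d : ℕ) : ZMod N)) =
        s(((g * (c : ℤ) + r : ℤ) : ZMod N), ((g * ((c : ℤ) + k) + r : ℤ) : ZMod N)) := by
      have h1 : ((g * c + r + g * k : ℕ) : ZMod N) = ((g * ((c : ℤ) + k) + r : ℤ) : ZMod N) := by
        push_cast
        ring
      rw [hx, hk, h1]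
      push_cast
      rfl
    rw [hedge]
    -- Either the edge is a step of the progression, or t = h - 1 and it is the closing edge, which
    -- a zigzag covers.
    rcases Nat.lt_or_ge t (h - 1) with hth | hth
    · refine ⟨P d, ?_, ?_⟩
      · exact Finset.mem_union_left _ (Finset.mem_image_of_mem _
          (Finset.mem_Icc.2 ⟨hd, by omega⟩))
      · rw [hPd, ← rung_eq_of_modEq hh hct hct']
        exact rung_mem_snake_edges hr hth
    · have hstart : progression k (t + 1) = ((k / 4 + k % 2 : ℕ) : ℤ) + h * k := by
        have h1 : t + 1 = h := by omega
        rw [h1, progression]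
      have h1 : (h : ℤ) ∣ ((c : ℤ) + k) - (k / 4 + k % 2 : ℕ) := by
        have h2 := hct'.add (Dvd.intro (k : ℤ) rfl : (h : ℤ) ∣ h * k)
        rw [hstart] at h2
        have h3 : (c : ℤ) + k - (k / 4 + k % 2 : ℕ) =
            (c : ℤ) + k - ((k / 4 + k % 2 : ℕ) + h * k) + h * k := by ring
        rwa [h3]
      have h2 : (h : ℤ) ∣ (c : ℤ) - (((k / 4 + k % 2 : ℕ) : ℤ) - k) := by
        rwa [← sub_add, sub_add_eq_add_sub]
      obtain ⟨j, hj, z, hz, hzj⟩ := exists_zigzag_edge hkpos hkh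
      refine ⟨F g z ((h + 1) / 4), ?_, ?_⟩
      · rw [← hh']
        refine Finset.mem_union_right _ ?_
        rcases hz with rfl | rfl
        · exact Finset.mem_union_left _ (Finset.mem_image_of_mem A hgN)
        · exact Finset.mem_union_right _ (Finset.mem_image_of_mem B hgN)
      · rcases hzj with ⟨h3, h4⟩ | ⟨h3, h4⟩
        · rw [Sym2.eq_swap, ← rung_eq_of_modEq hh (z := z) (t := j) (by rwa [h3]) (by rwa [h4])]
          exact rung_mem_snake_edges hr hj
        · rw [← rung_eq_of_modEq hh (z := z) (t := j) (by rwa [h4]) (by rwa [h3])]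
          exact rung_mem_snake_edges hr hj

/-! ### Paths made of two sum classes. -/

/-- The sum of the two ends of an edge, where the edge from `none` to `x` has the sum `2 * x`. -/
def optionSum {N : ℕ} : Sym2 (Option (ZMod N)) → ZMod N :=
  Sym2.lift ⟨fun
    | some x, some y => x + y
    | some x, none => 2 * x
    | none, some y => 2 * y
    | none, none => 0, by rintro (_ | x) (_ | y) <;> simp [add_comm]⟩

@[simp] theorem optionSum_some_some {N : ℕ} (x y : ZMod N) :
    optionSum s(some x, some y) = x + y := rfl

@[simp] theorem optionSum_none_some {N : ℕ} (y : ZMod N) :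
    optionSum s(none, some y) = 2 * y := rfl

@[simp] theorem optionSum_some_none {N : ℕ} (x : ZMod N) :
    optionSum s(some x, none) = 2 * x := rfl

/-- The sequence `1, -1, 2, -2, …`. -/
def alternating (i : ℕ) : ℤ := if i % 2 = 0 then 1 + ((i / 2 : ℕ) : ℤ) else -1 - ((i / 2 : ℕ) : ℤ)

/-- The sequence `x + 1, x - 1, …, x + m, x - m, none, x` in `Option (ZMod (2 * m + 1))`. -/
def centered (m : ℕ) (x : ZMod (2 * m + 1)) (i : ℕ) : Option (ZMod (2 * m + 1)) :=
  if i = 2 * m then none else if i = 2 * m + 1 then some x else some (x + (alternating i : ℤ))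

theorem centered_of_lt {m : ℕ} {x : ZMod (2 * m + 1)} {i : ℕ} (hi : i < 2 * m) :
    centered m x i = some (x + (alternating i : ℤ)) := by
  rw [centered, if_neg (by omega), if_neg (by omega)]

theorem centered_two_mul (m : ℕ) (x : ZMod (2 * m + 1)) : centered m x (2 * m) = none := by
  simp [centered]

theorem centered_two_mul_add_one (m : ℕ) (x : ZMod (2 * m + 1)) :
    centered m x (2 * m + 1) = some x := by
  simp [centered]

theorem intCast_injOn {m : ℕ} {a b : ℤ} (ha : |a| ≤ m) (hb : |b| ≤ m)
    (h : (a : ZMod (2 * m + 1)) = (b : ZMod (2 * m + 1))) : a = b := by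
  rw [ZMod.intCast_eq_intCast_iff_dvd_sub] at h
  rw [abs_le] at ha hb
  have := Int.eq_zero_of_abs_lt_dvd h (by rw [abs_lt]; push_cast; omega)
  omega

theorem abs_alternating_le {m i : ℕ} (hi : i < 2 * m) : |alternating i| ≤ m := by
  rw [abs_le]
  simp only [alternating]
  split_ifs <;> omega

theorem alternating_injective : Function.Injective alternating := by
  intro i j h
  simp only [alternating] at h
  split_ifs at h <;> omega

theorem alternating_ne_zero (i : ℕ) : alternating i ≠ 0 := by
  simp only [alternating]
  split_ifs <;> omega

theorem centered_injOn (m : ℕ) (x : ZMod (2 * m + 1)) :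
    Set.InjOn (centered m x) (Set.Iic (2 * m + 1)) := by
  have hx : ∀ i < 2 * m, x + (alternating i : ℤ) ≠ x := by
    intro i hi h
    have h1 : ((alternating i : ℤ) : ZMod (2 * m + 1)) = ((0 : ℤ) : ZMod (2 * m + 1)) := by
      simpa using h
    exact alternating_ne_zero i (intCast_injOn (abs_alternating_le hi) (by simp) h1)
  have key : ∀ i < 2 * m, ∀ j ≤ 2 * m + 1, centered m x i = centered m x j → i = j := by
    intro i hi j hj h
    rw [centered_of_lt hi] at h
    rcases lt_trichotomy j (2 * m) with h1 | rfl | h1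
    · rw [centered_of_lt h1, Option.some_inj, add_right_inj] at h
      exact alternating_injective
        (intCast_injOn (abs_alternating_le hi) (abs_alternating_le h1) h)
    · simp [centered_two_mul] at h
    · obtain rfl : j = 2 * m + 1 := by omega
      rw [centered_two_mul_add_one, Option.some_inj] at h
      exact absurd h (hx i hi)
  intro i hi j hj h
  rw [Set.mem_Iic] at hi hj
  rcases Nat.lt_or_ge i (2 * m) with h1 | h1
  · exact key i h1 j hj h
  rcases Nat.lt_or_ge j (2 * m) with h2 | h2
  · exact (key j h2 i hi h.symm).symm
  rcases (by omega : i = 2 * m ∨ i = 2 * m + 1) with rfl | rfl <;>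
    rcases (by omega : j = 2 * m ∨ j = 2 * m + 1) with rfl | rfl <;>
    simp_all [centered_two_mul, centered_two_mul_add_one]

/-- Since `none` is the last vertex but one, deleting it removes only the final two edges and leaves
a path. This serves odd n. -/
theorem preimage_some_centered (m : ℕ) (x : ZMod (2 * m + 1)) :
    Sym2.map some ⁻¹' pathEdges (centered m x) (2 * m + 1) =
      pathEdges (fun i => x + ((alternating i : ℤ) : ZMod (2 * m + 1))) (2 * m - 1) := by
  have hinj : Function.Injective (Sym2.map (some : ZMod (2 * m + 1) → Option (ZMod (2 * m + 1)))) :=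
    Sym2.map.injective (Option.some_injective _)
  have hnone : ∀ (e : Sym2 (ZMod (2 * m + 1))), none ∉ Sym2.map some e := by
    intro e
    simp [Sym2.mem_map]
  ext e
  constructor
  · rintro ⟨i, hi, h⟩
    rcases Nat.lt_or_ge i (2 * m - 1) with h1 | h1
    · refine ⟨i, h1, hinj ?_⟩
      rw [h, centered_of_lt (by omega), centered_of_lt (by omega)]
      rfl
    · exfalso
      apply hnone e
      rw [h]
      rcases (by omega : i = 2 * m ∨ i + 1 = 2 * m) with h2 | h2
      · rw [h2, centered_two_mul]
        simp
      · rw [h2, centered_two_mul]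
        simp
  · rintro ⟨i, hi, rfl⟩
    refine ⟨i, by omega, ?_⟩
    rw [centered_of_lt (by omega), centered_of_lt (by omega)]
    rfl

theorem two_mul_injective (m : ℕ) : Function.Injective fun y : ZMod (2 * m + 1) => 2 * y := by
  intro y y' h
  have h1 : ((m : ZMod (2 * m + 1)) + 1) * 2 = 1 := by
    have h2 : ((2 * m + 1 : ℕ) : ZMod (2 * m + 1)) = 0 := ZMod.natCast_self _
    push_cast at h2
    linear_combination h2
  calc y = ((m : ZMod (2 * m + 1)) + 1) * (2 * y) := by rw [← mul_assoc, h1, one_mul]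
    _ = ((m : ZMod (2 * m + 1)) + 1) * (2 * y') := congrArg _ h
    _ = y' := by rw [← mul_assoc, h1, one_mul]

theorem two_mul_neg_cast (m : ℕ) : 2 * (-(m : ZMod (2 * m + 1))) = 1 := by
  have h2 : ((2 * m + 1 : ℕ) : ZMod (2 * m + 1)) = 0 := ZMod.natCast_self _
  push_cast at h2
  linear_combination -h2

/-- Steps from x + a to x - a have sum 2x, and steps from x - a to x + a + 1 have sum 2x + 1. The
edge from x - m to `none` fits as well, because -2m = 1. -/
theorem optionSum_of_mem_centered {m : ℕ} {x : ZMod (2 * m + 1)}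
    {e : Sym2 (Option (ZMod (2 * m + 1)))} (he : e ∈ pathEdges (centered m x) (2 * m + 1)) :
    optionSum e = 2 * x ∨ optionSum e = 2 * x + 1 := by
  obtain ⟨i, hi, rfl⟩ := he
  rcases lt_trichotomy (i + 1) (2 * m) with h | h | h
  · rw [centered_of_lt (by omega), centered_of_lt (by omega), optionSum_some_some]
    rcases (by simp only [alternating]; split_ifs <;> omega :
        alternating (i + 1) = -alternating i ∨ alternating (i + 1) = 1 - alternating i) with h1 | h1
    · left
      rw [h1]
      push_cast
      ring
    · right
      rw [h1]
      push_cast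
      ring
  · right
    have h1 : alternating i = -m := by
      simp only [alternating]
      split_ifs <;> omega
    rw [h, centered_two_mul, centered_of_lt (by omega), optionSum_some_none, h1, mul_add]
    push_cast
    rw [two_mul_neg_cast]
  · left
    obtain rfl : i = 2 * m := by omega
    rw [centered_two_mul, centered_two_mul_add_one, optionSum_none_some]

theorem mem_centered {m : ℕ} (hm : 0 < m) {x : ZMod (2 * m + 1)}
    {e : Sym2 (Option (ZMod (2 * m + 1)))} (hd : ¬ e.IsDiag)
    (hc : ∀ y, e ≠ s(some y, some (y + 1)))
    (he : optionSum e = 2 * x ∨ optionSum e = 2 * x + 1) :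
    e ∈ pathEdges (centered m x) (2 * m + 1) := by
  have hinf : ∀ y : ZMod (2 * m + 1), 2 * y = 2 * x ∨ 2 * y = 2 * x + 1 →
      s(none, some y) ∈ pathEdges (centered m x) (2 * m + 1) := by
    rintro y (h | h)
    · refine ⟨2 * m, by omega, ?_⟩
      rw [centered_two_mul, centered_two_mul_add_one, two_mul_injective m h]
    · refine ⟨2 * m - 1, by omega, ?_⟩
      have h1 : alternating (2 * m - 1) = -m := by
        simp only [alternating]
        split_ifs <;> omega
      have h2 : y = x + -(m : ZMod (2 * m + 1)) := by
        apply two_mul_injective m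
        simp only [mul_add, two_mul_neg_cast, h]
      rw [Nat.sub_add_cancel (by omega), centered_two_mul, centered_of_lt (by omega), h1, h2,
        Sym2.eq_swap]
      push_cast
      rfl
  -- the edges between `x + a` and `x - a`, and between `x + a` and `x + 1 - a`
  have heven : ∀ a : ℤ, 0 < a → a ≤ m →
      s(some (x + (a : ZMod (2 * m + 1))), some (x + ((-a : ℤ) : ZMod (2 * m + 1)))) ∈
        pathEdges (centered m x) (2 * m + 1) := by
    intro a ha ham
    lift a to ℕ using ha.le
    refine ⟨2 * (a - 1), by omega, ?_⟩
    have h1 : alternating (2 * (a - 1)) = a := by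
      simp only [alternating]
      split_ifs <;> omega
    have h2 : alternating (2 * (a - 1) + 1) = -a := by
      simp only [alternating]
      split_ifs <;> omega
    rw [centered_of_lt (by omega), centered_of_lt (by omega), h1, h2]
  have hodd : ∀ a : ℤ, 1 < a → a ≤ m →
      s(some (x + (a : ZMod (2 * m + 1))), some (x + ((1 - a : ℤ) : ZMod (2 * m + 1)))) ∈
        pathEdges (centered m x) (2 * m + 1) := by
    intro a ha ham
    lift a to ℕ using (by omega)
    refine ⟨2 * (a - 2) + 1, by omega, ?_⟩
    have h1 : alternating (2 * (a - 2) + 1) = 1 - a := by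
      simp only [alternating]
      split_ifs <;> omega
    have h2 : alternating (2 * (a - 2) + 1 + 1) = a := by
      simp only [alternating]
      split_ifs <;> omega
    rw [centered_of_lt (by omega), centered_of_lt (by omega), h1, h2, Sym2.eq_swap]
  induction e using Sym2.ind with
  | _ u v =>
    rw [Sym2.mk_isDiag_iff] at hd
    rcases u with _ | y <;> rcases v with _ | y'
    · exact absurd rfl hd
    · exact hinf y' he
    · rw [Sym2.eq_swap]
      exact hinf y he
    · rw [optionSum_some_some] at he
      have hyy' : y ≠ y' := fun h => hd (congrArg some h)
      set a : ℤ := (y - x).valMinAbs with ha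
      have hay : y = x + (a : ZMod (2 * m + 1)) := by
        rw [ha, ZMod.coe_valMinAbs]
        ring
      have hbound : |a| ≤ m := by
        have := ZMod.natAbs_valMinAbs_le (y - x)
        rw [← ha] at this
        rw [abs_le]
        omega
      rw [abs_le] at hbound
      rcases he with he | he
      · have hy' : y' = x + ((-a : ℤ) : ZMod (2 * m + 1)) := by
          push_cast
          rw [hay] at he
          linear_combination he
        have ha0 : a ≠ 0 := by
          intro h
          apply hyy'
          rw [hay, hy', h]
          simp
        rw [hay, hy']
        rcases lt_or_gt_of_ne ha0 with h | h
        · rw [Sym2.eq_swap]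
          have := heven (-a) (by omega) (by omega)
          rwa [neg_neg] at this
        · exact heven a h (by omega)
      · have hy' : y' = x + ((1 - a : ℤ) : ZMod (2 * m + 1)) := by
          push_cast
          rw [hay] at he
          linear_combination he
        -- The values 0 and 1 give the cyclic edge {x, x + 1}, the one edge of sum 2x + 1 that the
        -- path omits; -m would give a loop.
        have ha0 : a ≠ 0 := by
          intro h
          apply hc y
          rw [hy', hay, h]
          simp
        have ha1 : a ≠ 1 := by
          intro h
          apply hc y'
          rw [hy', hay, h, Sym2.eq_swap]
          simp
        have ham : a ≠ -m := by
          intro h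
          apply hyy'
          rw [hay, hy', h]
          push_cast
          have := two_mul_neg_cast m
          linear_combination this
        rw [hay, hy']
        rcases lt_or_ge 1 a with h | h
        · exact hodd a h (by omega)
        · rw [Sym2.eq_swap]
          have := hodd (1 - a) (by omega) (by omega)
          rwa [sub_sub_cancel] at this

theorem card_filter_mod_three (N : ℕ) :
    ((Finset.range N).filter fun s => s % 3 ≠ 2).card = N - N / 3 := by
  induction N with
  | zero => simp
  | succ N ih =>
    rw [Finset.range_add_one, Finset.filter_insert]
    split_ifs with h
    · rw [Finset.card_insert_of_notMem (by simp), ih]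
      omega
    · rw [ih]
      omega

/-- The sums `a` and `b` are told apart by one of the pairs `{s, s + 1}` with `s % 3 ≠ 2`. -/
theorem exists_pair_separating {N a b : ℕ} (hN : 3 ≤ N) (hab : a ≠ b) (ha : a < N) (hb : b < N) :
    ∃ s < N, s % 3 ≠ 2 ∧ ¬ ((a = s ∨ a = (s + 1) % N) ↔ (b = s ∨ b = (s + 1) % N)) := by
  have hmod : ∀ s < N, ∀ c < N, (c = (s + 1) % N ↔ (s + 1 < N ∧ c = s + 1) ∨ (s + 1 = N ∧ c = 0)) := by
    intro s hs c hc
    rcases Nat.lt_or_ge (s + 1) N with h | h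
    · rw [Nat.mod_eq_of_lt h]
      omega
    · obtain rfl : N = s + 1 := by omega
      rw [Nat.mod_self]
      omega
  have key : ∀ a b : ℕ, a < b → b < N →
      ∃ s < N, s % 3 ≠ 2 ∧ ¬ ((a = s ∨ a = (s + 1) % N) ↔ (b = s ∨ b = (s + 1) % N)) := by
    intro a b hab hb
    have red : ∀ s < N, s % 3 ≠ 2 →
        ¬ ((a = s ∨ (s + 1 < N ∧ a = s + 1) ∨ (s + 1 = N ∧ a = 0)) ↔
          (b = s ∨ (s + 1 < N ∧ b = s + 1) ∨ (s + 1 = N ∧ b = 0))) →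
        ∃ s < N, s % 3 ≠ 2 ∧ ¬ ((a = s ∨ a = (s + 1) % N) ↔ (b = s ∨ b = (s + 1) % N)) := by
      intro s hs h3 h
      refine ⟨s, hs, h3, ?_⟩
      rwa [hmod s hs a (by omega), hmod s hs b hb]
    -- Use a pair containing the larger number b: {b - 1, b} or {b, b + 1}. It fails only if it also
    -- contains a, by adjacency or by wrapping round to 0; then a pair containing a but not b is
    -- available.
    by_cases h3 : b % 3 = 2
    · by_cases h : a + 1 = b
      · exact red (a - 1) (by omega) (by omega) (by omega)
      · exact red (b - 1) (by omega) (by omega) (by omega)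
    · by_cases h : a = 0 ∧ b + 1 = N
      · exact red 0 (by omega) (by omega) (by omega)
      · exact red b (by omega) (by omega) (by omega)
  rcases lt_or_gt_of_ne hab with h | h
  · exact key a b h hb
  · obtain ⟨s, hs, h3, hh⟩ := key b a h ha
    exact ⟨s, hs, h3, fun H => hh H.symm⟩

theorem exists_sum_family {m : ℕ} (hm : 0 < m) :
    ∃ S : Finset (Set (Sym2 (Option (ZMod (2 * m + 1))))),
      (∀ M ∈ S, IsPathSeq M ∧ IsPathSeq (Sym2.map some ⁻¹' M)) ∧
      S.card ≤ (2 * m + 1) - (2 * m + 1) / 3 ∧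
      ∀ e e' : Sym2 (Option (ZMod (2 * m + 1))), ¬ e.IsDiag → ¬ e'.IsDiag →
        (∀ y, e ≠ s(some y, some (y + 1))) → (∀ y, e' ≠ s(some y, some (y + 1))) →
        optionSum e ≠ optionSum e' → ∃ M ∈ S, Separates M e e' := by
  classical
  have hsurj : ∀ s : ℕ, ∃ x : ZMod (2 * m + 1), 2 * x = s := by
    intro s
    refine ⟨-(m : ZMod (2 * m + 1)) * s, ?_⟩
    rw [← mul_assoc, two_mul_neg_cast, one_mul]
  choose c hc using hsurj
  refine ⟨((Finset.range (2 * m + 1)).filter fun s => s % 3 ≠ 2).image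
    fun s => pathEdges (centered m (c s)) (2 * m + 1), ?_, ?_, ?_⟩
  · intro M hM
    obtain ⟨s, -, rfl⟩ := Finset.mem_image.1 hM
    refine ⟨⟨_, _, centered_injOn m _, rfl⟩, ?_⟩
    rw [preimage_some_centered m]
    refine ⟨_, _, ?_, rfl⟩
    intro i hi j hj h
    rw [Set.mem_Iic] at hi hj
    refine centered_injOn m (c s) (Set.mem_Iic.2 (by omega)) (Set.mem_Iic.2 (by omega)) ?_
    rw [centered_of_lt (by omega), centered_of_lt (by omega)]
    exact congrArg some h
  · exact Finset.card_image_le.trans (card_filter_mod_three _).le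
  · intro e e' hd hd' hcyc hcyc' hne
    obtain ⟨s, hs, h3, h⟩ := exists_pair_separating (by omega : 3 ≤ 2 * m + 1)
      ((ZMod.val_injective _).ne hne) (ZMod.val_lt _) (ZMod.val_lt _)
    refine ⟨_, Finset.mem_image_of_mem _ (Finset.mem_filter.2 ⟨Finset.mem_range.2 hs, h3⟩), ?_⟩
    have hval : ∀ u : ZMod (2 * m + 1), (u.val = s ∨ u.val = (s + 1) % (2 * m + 1)) ↔
        (u = 2 * c s ∨ u = 2 * c s + 1) := by
      intro u
      have h1 : ∀ t : ℕ, u.val = t % (2 * m + 1) ↔ u = (t : ZMod (2 * m + 1)) := by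
        intro t
        rw [← ZMod.val_natCast]
        exact (ZMod.val_injective _).eq_iff
      have h2 := h1 s
      rw [Nat.mod_eq_of_lt hs] at h2
      rw [h2, h1, hc]
      push_cast
      rfl
    rw [hval, hval] at h
    have hmem : ∀ e : Sym2 (Option (ZMod (2 * m + 1))), ¬ e.IsDiag →
        (∀ y, e ≠ s(some y, some (y + 1))) →
        (e ∈ pathEdges (centered m (c s)) (2 * m + 1) ↔
          (optionSum e = 2 * c s ∨ optionSum e = 2 * c s + 1)) :=
      fun e hd hcyc => ⟨optionSum_of_mem_centered, mem_centered hm hd hcyc⟩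
    rw [← hmem e hd hcyc, ← hmem e' hd' hcyc'] at h
    unfold Separates
    tauto

/-! ### Counting and assembling the three families. -/

theorem card_properDivisors_le_of_odd {N : ℕ} (hodd : Odd N) :
    N.properDivisors.card ≤ 6 + N / 26 := by
  have hsub : N.properDivisors ⊆ (Finset.range 6).image (fun q => 2 * q + 1) ∪
      (Finset.Icc 1 (N / 26)).image fun q => N / (2 * q + 1) := by
    intro g hg
    obtain ⟨⟨h, hh⟩, hlt⟩ := Nat.mem_properDivisors.1 hg
    have h1 := hodd
    rw [hh, Nat.odd_mul] at h1
    obtain ⟨⟨p, hp⟩, ⟨q, hq⟩⟩ := h1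
    rw [Finset.mem_union, Finset.mem_image, Finset.mem_image]
    -- A divisor is one of 1, 3, …, 11, or is at least 13; then its codivisor 2q + 1 is at most
    -- N/13, so q ≤ N/26.
    rcases Nat.lt_or_ge p 6 with h6 | h6
    · exact Or.inl ⟨p, Finset.mem_range.2 h6, hp.symm⟩
    · refine Or.inr ⟨q, Finset.mem_Icc.2 ⟨?_, ?_⟩, ?_⟩
      · rcases Nat.eq_zero_or_pos q with rfl | hq0
        · rw [hq, mul_zero, zero_add, mul_one] at hh
          omega
        · exact hq0
      · rw [Nat.le_div_iff_mul_le (by norm_num)]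
        have h2 : 13 * h ≤ g * h := Nat.mul_le_mul_right h (by omega)
        omega
      · rw [← hq, hh]
        exact Nat.mul_div_cancel _ (by omega)
  refine (Finset.card_le_card hsub).trans ((Finset.card_union_le _ _).trans
    (Nat.add_le_add ?_ ?_))
  · exact Finset.card_image_le.trans (by simp)
  · exact Finset.card_image_le.trans (by simp)

theorem exists_separating_family {m : ℕ} (hm : 0 < m) :
    ∃ S : Finset (Set (Sym2 (Option (ZMod (2 * m + 1))))),
      (∀ M ∈ S, IsPathSeq M ∧ IsPathSeq (Sym2.map some ⁻¹' M)) ∧ SeparatesAll S ∧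
      S.card ≤ ((2 * m + 1) - (2 * m + 1) / 3) +
        ((Nat.log 2 (2 * m + 1) + 3) + (m + 2 * (2 * m + 1).properDivisors.card)) := by
  classical
  obtain ⟨S₁, hp₁, hc₁, hs₁⟩ := exists_sum_family hm
  obtain ⟨S₂, hp₂, hc₂, hs₂⟩ := exists_cyclic_family (by omega : 3 ≤ 2 * m + 1)
  obtain ⟨S₃, hp₃, hc₃, hs₃⟩ := exists_rainbow_family (⟨m, rfl⟩ : Odd (2 * m + 1))
  set φ : Sym2 (ZMod (2 * m + 1)) → Sym2 (Option (ZMod (2 * m + 1))) := Sym2.map some with hφ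
  have hinj : Function.Injective φ := Sym2.map.injective (Option.some_injective _)
  have hmem : ∀ (M : Set (Sym2 (ZMod (2 * m + 1)))) e, φ e ∈ φ '' M ↔ e ∈ M :=
    fun M e => hinj.mem_set_image
  -- an edge is the image of an edge or contains `none`
  have hcases : ∀ e : Sym2 (Option (ZMod (2 * m + 1))), ¬ e.IsDiag →
      (∃ e₀, ¬ e₀.IsDiag ∧ e = φ e₀ ∧ optionSum e = endSum e₀) ∨
        ∃ y, e = s(none, some y) := by
    intro e he
    induction e using Sym2.ind with
    | _ u v =>
      rw [Sym2.mk_isDiag_iff] at he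
      rcases u with _ | y <;> rcases v with _ | y'
      · exact absurd rfl he
      · exact Or.inr ⟨y', rfl⟩
      · exact Or.inr ⟨y, Sym2.eq_swap⟩
      · refine Or.inl ⟨s(y, y'), ?_, rfl, rfl⟩
        rw [Sym2.mk_isDiag_iff]
        exact fun h => he (congrArg some h)
  have hnone : ∀ y e₀, s(none, some y) ≠ φ e₀ := by
    intro y e₀ h
    have h1 : none ∈ φ e₀ := h ▸ Sym2.mem_mk_left _ _
    simp [hφ, Sym2.mem_map] at h1
  refine ⟨S₁ ∪ (S₂ ∪ S₃).image fun M => φ '' M, ?_, ?_, ?_⟩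
  · intro M hM
    rcases Finset.mem_union.1 hM with h | h
    · exact hp₁ M h
    · obtain ⟨M₀, h₀, rfl⟩ := Finset.mem_image.1 h
      have hpath : IsPathSeq M₀ := by
        rcases Finset.mem_union.1 h₀ with h | h
        · exact hp₂ _ h
        · exact (hp₃ _ h).1
      refine ⟨hpath.image (Option.some_injective _), ?_⟩
      rw [Set.preimage_image_eq _ hinj]
      exact hpath
  · have hS : ∀ M₀, M₀ ∈ S₂ ∨ M₀ ∈ S₃ → φ '' M₀ ∈ S₁ ∪ (S₂ ∪ S₃).image fun M => φ '' M :=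
      fun M₀ h => Finset.mem_union_right _ (Finset.mem_image_of_mem _ (Finset.mem_union.2 h))
    -- a cyclic edge is separated from every other edge
    have hcyc : ∀ e₀ e', IsCyclicEdge e₀ → ¬ e'.IsDiag → φ e₀ ≠ e' →
        ∃ M ∈ S₁ ∪ (S₂ ∪ S₃).image fun M => φ '' M, Separates M (φ e₀) e' := by
      intro e₀ e' hc hd hne
      rcases hcases e' hd with ⟨e₁, -, rfl, -⟩ | ⟨y, rfl⟩
      · obtain ⟨M, hM, h⟩ := hs₂ e₀ e₁ hc (fun h => hne (h ▸ rfl))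
        exact ⟨_, hS M (Or.inl hM), by simpa only [Separates, hmem] using h⟩
      -- Any path covering `e₀` in `ZMod N` will do, since it avoids `none`.
      · obtain ⟨M, hM, h₀⟩ : ∃ M ∈ S₃, e₀ ∈ M := by
          refine hs₃ e₀ ?_
          obtain ⟨x, rfl⟩ := hc
          have : Fact (1 < 2 * m + 1) := ⟨by omega⟩
          simp [Sym2.mk_isDiag_iff]
        refine ⟨_, hS M (Or.inr hM), Or.inl ⟨(hmem _ _).2 h₀, ?_⟩⟩
        rintro ⟨e₁, -, h⟩
        exact hnone y e₁ h.symm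
    -- an edge without `none` is separated from the noncyclic edges of the same sum
    have hrain : ∀ e₀ e', ¬ e₀.IsDiag → ¬ IsCyclicEdge e₀ → ¬ e'.IsDiag →
        (∀ y, e' ≠ s(some y, some (y + 1))) → φ e₀ ≠ e' → optionSum e' = endSum e₀ →
        ∃ M ∈ S₁ ∪ (S₂ ∪ S₃).image fun M => φ '' M, Separates M (φ e₀) e' := by
      intro e₀ e' hd₀ hc₀ hd' hc' hne hsum
      obtain ⟨M, hM, h⟩ := hs₃ e₀ hd₀
      refine ⟨_, hS M (Or.inr hM), Or.inl ⟨(hmem _ _).2 h, ?_⟩⟩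
      rintro ⟨e₁, h₁, rfl⟩
      refine hne (congrArg φ ((hp₃ M hM).2 e₀ h e₁ h₁ hc₀ ?_ ?_))
      · rintro ⟨y, rfl⟩
        exact hc' y rfl
      · rw [← hsum]
        induction e₁ using Sym2.ind with
        | _ u v => rfl
    have hsymm : ∀ (M : Set (Sym2 (Option (ZMod (2 * m + 1))))) e e',
        Separates M e e' → Separates M e' e := fun M e e' h => Or.symm h
    intro e e' hd hd' hne
    by_cases hc : ∃ y, e = s(some y, some (y + 1))
    · obtain ⟨y, rfl⟩ := hc
      exact hcyc s(y, y + 1) e' ⟨y, rfl⟩ hd' hne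
    by_cases hc' : ∃ y, e' = s(some y, some (y + 1))
    · obtain ⟨y, rfl⟩ := hc'
      obtain ⟨M, hM, h⟩ := hcyc s(y, y + 1) e ⟨y, rfl⟩ hd hne.symm
      exact ⟨M, hM, hsymm _ _ _ h⟩
    by_cases hsum : optionSum e = optionSum e'
    swap
    · obtain ⟨M, hM, h⟩ := hs₁ e e' hd hd' (not_exists.1 hc) (not_exists.1 hc') hsum
      exact ⟨M, Finset.mem_union_left _ hM, h⟩
    rcases hcases e hd with ⟨e₀, hd₀, rfl, h₀⟩ | ⟨y, rfl⟩
    · refine hrain e₀ e' hd₀ ?_ hd' (not_exists.1 hc') hne (hsum.symm.trans h₀)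
      rintro ⟨y, rfl⟩
      exact hc ⟨y, rfl⟩
    rcases hcases e' hd' with ⟨e₀, hd₀, rfl, h₀⟩ | ⟨y', rfl⟩
    · obtain ⟨M, hM, h⟩ := hrain e₀ _ hd₀ (by rintro ⟨y, rfl⟩; exact hc' ⟨y, rfl⟩) hd
        (not_exists.1 hc) hne.symm (hsum.trans h₀)
      exact ⟨M, hM, hsymm _ _ _ h⟩
    -- Two distinct edges at `none` never share a sum, as 2 is invertible modulo 2m + 1.
    · exact absurd (congrArg (fun z => s(none, some z)) (two_mul_injective m hsum)) hne
  · refine (Finset.card_union_le _ _).trans (Nat.add_le_add hc₁ ?_)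
    refine Finset.card_image_le.trans ((Finset.card_union_le _ _).trans (Nat.add_le_add hc₂ ?_))
    rwa [Nat.add_sub_cancel, Nat.mul_div_cancel_left _ (by norm_num)] at hc₃

theorem exists_system_le {n : ℕ} (hn : 44 ≤ n) : ∃ S : Finset (Set (Sym2 (Fin n))),
    IsSeparatingPathSystem (⊤ : SimpleGraph (Fin n)) (S : Set (Set (Sym2 (Fin n)))) ∧
      16 * S.card ≤ 21 * n + 16 * Nat.log 2 n + 232 := by
  classical
  obtain ⟨m, hm⟩ : ∃ m, n = 2 * m + 1 ∨ n = 2 * m + 2 := ⟨(n - 1) / 2, by omega⟩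
  obtain ⟨S, hpath, hsep, hcard⟩ := exists_separating_family (by omega : 0 < m)
  have hdiv := card_properDivisors_le_of_odd (⟨m, rfl⟩ : Odd (2 * m + 1))
  have hlog : Nat.log 2 (2 * m + 1) ≤ Nat.log 2 n := Nat.log_mono_right (by omega)
  have hbound : 16 * S.card ≤ 21 * n + 16 * Nat.log 2 n + 232 := by omega
  rcases hm with rfl | rfl
  -- For odd n the extra vertex is deleted from every path; for even n it is kept as the last
  -- vertex.
  · obtain ⟨S', hS', hc'⟩ := exists_system_of_equiv (S.image fun M => Sym2.map some ⁻¹' M)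
      (by
        intro M hM
        obtain ⟨M₀, h₀, rfl⟩ := Finset.mem_image.1 hM
        exact (hpath M₀ h₀).2)
      (separatesAll_preimage_some hsep)
      (Fintype.equivFinOfCardEq (ZMod.card (2 * m + 1)))
    have := Finset.card_image_le (s := S)
      (f := fun M => (Sym2.map some ⁻¹' M : Set (Sym2 (ZMod (2 * m + 1)))))
    exact ⟨S', hS', by omega⟩
  · obtain ⟨S', hS', hc'⟩ := exists_system_of_equiv S (fun M hM => (hpath M hM).1) hsep
      (Fintype.equivFinOfCardEq (n := 2 * m + 2) (by
        rw [Fintype.card_option, ZMod.card]))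
    exact ⟨S', hS', by omega⟩

/-! ### The asymptotic form. -/

theorem f_le_card {V : Type*} [Finite V] {G : SimpleGraph V} {S : Finset (Set (Sym2 V))}
    (hS : IsSeparatingPathSystem G (S : Set (Set (Sym2 V)))) : f G ≤ S.card :=
  Nat.sInf_le ⟨S, hS, rfl⟩

theorem f_top_fin_zero : f (⊤ : SimpleGraph (Fin 0)) = 0 := by
  have hS : IsSeparatingPathSystem (⊤ : SimpleGraph (Fin 0))
      ((∅ : Finset (Set (Sym2 (Fin 0)))) : Set (Set (Sym2 (Fin 0)))) := by
    refine ⟨⟨by simp, ?_⟩, by simp⟩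
    intro e
    induction e using Sym2.ind with
    | _ u v => exact u.elim0
  exact Nat.le_zero.1 (f_le_card hS)

theorem tendsto_logb_div_atTop :
    Tendsto (fun n : ℕ => (16 * Real.logb 2 (n : ℝ) + 232) / (16 * (n : ℝ))) atTop (𝓝 0) := by
  have h1 : Tendsto (fun n : ℕ => Real.log (n : ℝ) / (n : ℝ)) atTop (𝓝 0) :=
    (Real.isLittleO_log_id_atTop.tendsto_div_nhds_zero).comp tendsto_natCast_atTop_atTop
  have h2 : Tendsto (fun n : ℕ => (1 : ℝ) / (n : ℝ)) atTop (𝓝 0) :=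
    tendsto_one_div_atTop_nhds_zero_nat
  have h3 := (h1.const_mul (1 / Real.log 2)).add (h2.const_mul (232 / 16))
  rw [mul_zero, mul_zero, add_zero] at h3
  refine h3.congr fun n => ?_
  rw [Real.logb]
  rcases Nat.eq_zero_or_pos n with rfl | hn
  · simp
  · have : (n : ℝ) ≠ 0 := by exact_mod_cast hn.ne'
    have : Real.log 2 ≠ 0 := (Real.log_pos (by norm_num)).ne'
    field_simp

end SepPath

theorem theorem1p2 :
    (∀ n : ℕ, 44 ≤ n → ∃ S : Finset (Set (Sym2 (Fin n))),
      SepPath.IsSeparatingPathSystem (⊤ : SimpleGraph (Fin n)) (S : Set (Set (Sym2 (Fin n)))) ∧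
      (S.card : ℝ) ≤ (21 * (n : ℝ) + 16 * Real.logb 2 (n : ℝ) + 232) / 16) ∧
    (∃ ε : ℕ → ℝ, Tendsto ε atTop (𝓝 0) ∧
      ∀ n : ℕ, (SepPath.f (⊤ : SimpleGraph (Fin n)) : ℝ) ≤ (21 / 16 + ε n) * (n : ℝ)) := by
  have main : ∀ n : ℕ, 44 ≤ n → ∃ S : Finset (Set (Sym2 (Fin n))),
      SepPath.IsSeparatingPathSystem (⊤ : SimpleGraph (Fin n)) (S : Set (Set (Sym2 (Fin n)))) ∧
      (S.card : ℝ) ≤ (21 * (n : ℝ) + 16 * Real.logb 2 (n : ℝ) + 232) / 16 := by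
    intro n hn
    obtain ⟨S, hS, hc⟩ := SepPath.exists_system_le hn
    refine ⟨S, hS, ?_⟩
    have h1 : ((Nat.log 2 n : ℕ) : ℝ) ≤ Real.logb 2 (n : ℝ) := by
      exact_mod_cast Real.natLog_le_logb n 2
    have h2 : (16 : ℝ) * S.card ≤ 21 * n + 16 * (Nat.log 2 n : ℕ) + 232 := by exact_mod_cast hc
    linarith
  -- Taking the actual excess as the error makes the inequality automatic for every n > 0, small n
  -- included; the explicit bound is needed only for the limit.
  refine ⟨main, fun n => max 0 ((SepPath.f (⊤ : SimpleGraph (Fin n)) : ℝ) / n - 21 / 16), ?_, ?_⟩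
  · refine squeeze_zero' (Eventually.of_forall fun n => le_max_left _ _) ?_
      SepPath.tendsto_logb_div_atTop
    filter_upwards [eventually_ge_atTop 44] with n hn
    have hn0 : (0 : ℝ) < n := by exact_mod_cast (by omega : 0 < n)
    have hlog : 0 ≤ Real.logb 2 (n : ℝ) :=
      Real.logb_nonneg (by norm_num) (by exact_mod_cast (by omega : 1 ≤ n))
    refine max_le (by positivity) ?_
    obtain ⟨S, hS, hc⟩ := main n hn
    have hf : (SepPath.f (⊤ : SimpleGraph (Fin n)) : ℝ) ≤ S.card := by
      exact_mod_cast SepPath.f_le_card hS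
    rw [sub_le_iff_le_add, div_le_iff₀ hn0]
    have h1 : ((16 * Real.logb 2 (n : ℝ) + 232) / (16 * n) + 21 / 16) * n =
        (21 * (n : ℝ) + 16 * Real.logb 2 (n : ℝ) + 232) / 16 := by
      field_simp
      ring
    rw [h1]
    exact hf.trans hc
  · intro n
    rcases Nat.eq_zero_or_pos n with rfl | hn
    · simp [SepPath.f_top_fin_zero]
    · have hn0 : (0 : ℝ) < n := by exact_mod_cast hn
      rw [← div_le_iff₀ hn0]
      have := le_max_right 0 ((SepPath.f (⊤ : SimpleGraph (Fin n)) : ℝ) / n - 21 / 16)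
      linarith
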